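/- Let $a, b, m, M \in \mathbb{R}$ with $b > 1$, and suppose that one of the following two cases holds: - $-1 < m \le 0$ and $M > -m(b+1)$; - $m > 0$ and $M \ge -2m$. Then there exists a unique concave function $f \in C^3([0,\infty))$ such that $$f''' + \frac{m+1}{2} f f'' + m\,(1 - f'^2) + M\,(1 - f') = 0 \quad \text{on } [0,\infty),$$ $$f(0) = a, \qquad f'(0) = b, \qquad \lim_{t\to\infty} f'(t) = 1.$$ Moreover, for this $f$ there exists a real number $l$ with $$a < l < \sqrt{a^2 + 4\,\frac{b-1}{m+1}}$$ such that $\lim_{t\to\infty}\bigl(f(t) - (t+l)\bigr) = 0$, and $t + a \le f(t) \le t + l$ for all $t \ge 0$. -/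

import Mathlib

open Set Filter Topology

/-- `f` is a classical (`C³`) solution on `[0, ∞)` of
`f''' + ((m+1)/2) f f'' + m (1 - f'^2) + M (1 - f') = 0`, `f 0 = a`, `f' 0 = b`, `f' (∞) = 1`.
Derivatives are taken within `[0, ∞)` (one-sided at `0`), so that the values of `f` on the
negative half-line play no role. -/
structure IsSolution (m M a b : ℝ) (f : ℝ → ℝ) : Prop where
  contDiffOn : ContDiffOn ℝ 3 f (Ici 0)
  equation : ∀ t : ℝ, 0 ≤ t →
    iteratedDerivWithin 3 f (Ici 0) t
      + (m + 1) / 2 * f t * iteratedDerivWithin 2 f (Ici 0) t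
      + m * (1 - derivWithin f (Ici 0) t ^ 2)
      + M * (1 - derivWithin f (Ici 0) t) = 0
  value_zero : f 0 = a
  deriv_zero : derivWithin f (Ici 0) 0 = b
  deriv_infty : Tendsto (fun t => derivWithin f (Ici 0) t) atTop (𝓝 1)

/-- A solution that is concave on `[0, ∞)`. -/
structure IsConcaveSolution (m M a b : ℝ) (f : ℝ → ℝ) : Prop extends
    IsSolution m M a b f where
  concaveOn : ConcaveOn ℝ (Ici 0) f

/-! ### Monotonicity from one-sided derivatives -/

/-! With u = f', w = f'', κ = (m+1)/2 the equation reads w' = -κ f w + φ(u), φ being `forcing m M`.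
The two cases on (m, M) serve only to give κ > 0 and φ > 0 on (1, b]; φ(1) = 0 always. Everything
else holds for any such φ that is Lipschitz on [1, b].

Existence is by shooting on c = w(0) ≤ 0, with u clamped to [1, b] so that trajectories are global.
The slopes for which w becomes positive, and those for which u < 1 and w < 0 at a common time, form
two disjoint open sets meeting (-∞, 0]. By connectedness some c avoids both; then w ≤ 0 and u ≥ 1
forever, the clamp is inactive, and u → 1 (`exists_isDecreasingProfile`).

Uniqueness takes u as independent variable. With v = f and p = -w, one has v' = -y/p and p' = κ v +
φ/p. If p₁(b) < p₂(b), the gap p₂ - p₁ can only widen as y decreases to 1, whereas p₂ becomes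
arbitrarily small and p₁ > 0 (`w_zero_le`). So f''(0) is determined, hence f.

For the asymptote, u - 1 decays exponentially, so f - t increases to a limit l. The decreasing
quantity u + (κ/2)(f - t)², compared at 0 and at infinity, bounds l² (`exists_asymptote`). -/

theorem monotoneOn_of_hasDerivWithinAt_Ici {g g' : ℝ → ℝ} {D : Set ℝ} (hD : Convex ℝ D)
    (hD0 : D ⊆ Ici 0) (hg : ∀ t, 0 ≤ t → HasDerivWithinAt g (g' t) (Ici 0) t)
    (h : ∀ t ∈ interior D, 0 ≤ g' t) : MonotoneOn g D :=
  monotoneOn_of_hasDerivWithinAt_nonneg hD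
    (fun t ht => ((hg t (hD0 ht)).mono hD0).continuousWithinAt)
    (fun t ht => (hg t (hD0 (interior_subset ht))).mono (interior_subset.trans hD0)) h

theorem antitoneOn_of_hasDerivWithinAt_Ici {g g' : ℝ → ℝ} {D : Set ℝ} (hD : Convex ℝ D)
    (hD0 : D ⊆ Ici 0) (hg : ∀ t, 0 ≤ t → HasDerivWithinAt g (g' t) (Ici 0) t)
    (h : ∀ t ∈ interior D, g' t ≤ 0) : AntitoneOn g D :=
  antitoneOn_of_hasDerivWithinAt_nonpos hD
    (fun t ht => ((hg t (hD0 ht)).mono hD0).continuousWithinAt)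
    (fun t ht => (hg t (hD0 (interior_subset ht))).mono (interior_subset.trans hD0)) h

theorem strictMonoOn_of_hasDerivWithinAt_Ici {g g' : ℝ → ℝ} {D : Set ℝ} (hD : Convex ℝ D)
    (hD0 : D ⊆ Ici 0) (hg : ∀ t, 0 ≤ t → HasDerivWithinAt g (g' t) (Ici 0) t)
    (h : ∀ t ∈ interior D, 0 < g' t) : StrictMonoOn g D :=
  strictMonoOn_of_hasDerivWithinAt_pos hD
    (fun t ht => ((hg t (hD0 ht)).mono hD0).continuousWithinAt)
    (fun t ht => (hg t (hD0 (interior_subset ht))).mono (interior_subset.trans hD0)) h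

theorem strictAntiOn_of_hasDerivWithinAt_Ici {g g' : ℝ → ℝ} {D : Set ℝ} (hD : Convex ℝ D)
    (hD0 : D ⊆ Ici 0) (hg : ∀ t, 0 ≤ t → HasDerivWithinAt g (g' t) (Ici 0) t)
    (h : ∀ t ∈ interior D, g' t < 0) : StrictAntiOn g D :=
  strictAntiOn_of_hasDerivWithinAt_neg hD
    (fun t ht => ((hg t (hD0 ht)).mono hD0).continuousWithinAt)
    (fun t ht => (hg t (hD0 (interior_subset ht))).mono (interior_subset.trans hD0)) h

/-- Only forward slopes enter, so t = 0 is allowed; this is needed when w has its maximum at the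
initial time. -/
theorem deriv_nonpos_of_isMaxOn_right {g : ℝ → ℝ} {d t : ℝ} (ht : 0 ≤ t)
    (hg : HasDerivWithinAt g d (Ici 0) t) (h : ∀ s, t ≤ s → g s ≤ g t) : d ≤ 0 := by
  have hd : HasDerivWithinAt g d (Ioi t) t := hg.mono (Ioi_subset_Ici ht)
  rw [hasDerivWithinAt_iff_tendsto_slope' self_notMem_Ioi] at hd
  refine le_of_tendsto hd ?_
  filter_upwards [self_mem_nhdsWithin] with s hs
  rw [slope_def_field]
  exact div_nonpos_of_nonpos_of_nonneg (sub_nonpos.2 (h s (le_of_lt hs)))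
    (sub_nonneg.2 (le_of_lt hs))

/-! ### Concave solutions as trajectories of a first-order system -/

/-- `(f, u, w)` is a trajectory on `[0, ∞)` of `f' = u`, `u' = w`, `w' = -κ f w + φ(u)` that starts
at `f = a`, `u = b`, along which `w ≤ 0`, and for which `u → 1`. -/
structure IsDecreasingProfile (κ : ℝ) (φ : ℝ → ℝ) (a b : ℝ) (f u w : ℝ → ℝ) : Prop where
  hasDeriv_f : ∀ t, 0 ≤ t → HasDerivWithinAt f (u t) (Ici 0) t
  hasDeriv_u : ∀ t, 0 ≤ t → HasDerivWithinAt u (w t) (Ici 0) t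
  hasDeriv_w : ∀ t, 0 ≤ t → HasDerivWithinAt w (-κ * f t * w t + φ (u t)) (Ici 0) t
  f_zero : f 0 = a
  u_zero : u 0 = b
  w_nonpos : ∀ t, 0 ≤ t → w t ≤ 0
  u_tendsto : Tendsto u atTop (𝓝 1)

/-- The nonlinearity `-m (1 - y²) - M (1 - y)`, factored. -/
def forcing (m M y : ℝ) : ℝ := (y - 1) * (m * (1 + y) + M)

theorem IsConcaveSolution.isDecreasingProfile {m M a b : ℝ} {f : ℝ → ℝ}
    (h : IsConcaveSolution m M a b f) :
    IsDecreasingProfile ((m + 1) / 2) (forcing m M) a b f (derivWithin f (Ici 0))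
      (derivWithin (derivWithin f (Ici 0)) (Ici 0)) := by
  have hs : UniqueDiffOn ℝ (Ici (0 : ℝ)) := uniqueDiffOn_Ici 0
  have h3 := h.contDiffOn
  rw [show (3 : WithTop ℕ∞) = 2 + 1 by norm_num, contDiffOn_succ_iff_derivWithin hs] at h3
  obtain ⟨d1, -, h2⟩ := h3
  rw [show (2 : WithTop ℕ∞) = 1 + 1 by norm_num, contDiffOn_succ_iff_derivWithin hs] at h2
  obtain ⟨d2, -, h1⟩ := h2
  rw [contDiffOn_one_iff_derivWithin hs] at h1
  obtain ⟨d3, -⟩ := h1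
  have e2 : iteratedDerivWithin 2 f (Ici 0) = derivWithin (derivWithin f (Ici 0)) (Ici 0) := by
    rw [show 2 = 1 + 1 from rfl, iteratedDerivWithin_succ, iteratedDerivWithin_one]
  have e3 : iteratedDerivWithin 3 f (Ici 0)
      = derivWithin (derivWithin (derivWithin f (Ici 0)) (Ici 0)) (Ici 0) := by
    rw [show 3 = 2 + 1 from rfl, iteratedDerivWithin_succ, e2]
  refine ⟨fun t ht => (d1 t ht).hasDerivWithinAt, fun t ht => (d2 t ht).hasDerivWithinAt,
    fun t ht => ?_, h.value_zero, h.deriv_zero, fun t ht => ?_, h.deriv_infty⟩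
  · have := h.equation t ht
    rw [e2, e3] at this
    refine (d3 t ht).hasDerivWithinAt.congr_deriv ?_
    simp only [forcing]
    linarith
  · exact (h.concaveOn.antitoneOn_derivWithin d1).derivWithin_nonpos

theorem IsDecreasingProfile.isConcaveSolution {m M a b : ℝ} {f u w : ℝ → ℝ}
    (h : IsDecreasingProfile ((m + 1) / 2) (forcing m M) a b f u w) :
    IsConcaveSolution m M a b f := by
  have hs : UniqueDiffOn ℝ (Ici (0 : ℝ)) := uniqueDiffOn_Ici 0
  have e1 : EqOn (derivWithin f (Ici 0)) u (Ici 0) :=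
    fun t ht => (h.hasDeriv_f t ht).derivWithin (hs t ht)
  have e2 : EqOn (derivWithin (derivWithin f (Ici 0)) (Ici 0)) w (Ici 0) := fun t ht => by
    rw [derivWithin_congr e1 (e1 ht)]
    exact (h.hasDeriv_u t ht).derivWithin (hs t ht)
  have e3 : EqOn (derivWithin (derivWithin (derivWithin f (Ici 0)) (Ici 0)) (Ici 0))
      (fun t => -((m + 1) / 2) * f t * w t + forcing m M (u t)) (Ici 0) := fun t ht => by
    rw [derivWithin_congr e2 (e2 ht)]
    exact (h.hasDeriv_w t ht).derivWithin (hs t ht)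
  have cf : ContinuousOn f (Ici 0) := fun t ht => (h.hasDeriv_f t ht).continuousWithinAt
  have cu : ContinuousOn u (Ici 0) := fun t ht => (h.hasDeriv_u t ht).continuousWithinAt
  have cw : ContinuousOn w (Ici 0) := fun t ht => (h.hasDeriv_w t ht).continuousWithinAt
  have i2 : iteratedDerivWithin 2 f (Ici 0) = derivWithin (derivWithin f (Ici 0)) (Ici 0) := by
    rw [show 2 = 1 + 1 from rfl, iteratedDerivWithin_succ, iteratedDerivWithin_one]
  have i3 : iteratedDerivWithin 3 f (Ici 0)
      = derivWithin (derivWithin (derivWithin f (Ici 0)) (Ici 0)) (Ici 0) := by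
    rw [show 3 = 2 + 1 from rfl, iteratedDerivWithin_succ, i2]
  refine ⟨⟨?_, fun t ht => ?_, h.f_zero, ?_, ?_⟩, ?_⟩
  · rw [show (3 : WithTop ℕ∞) = 2 + 1 by norm_num, contDiffOn_succ_iff_derivWithin hs]
    refine ⟨fun t ht => (h.hasDeriv_f t ht).differentiableWithinAt, fun h => by simp at h, ?_⟩
    rw [show (2 : WithTop ℕ∞) = 1 + 1 by norm_num, contDiffOn_succ_iff_derivWithin hs]
    refine ⟨fun t ht => ((h.hasDeriv_u t ht).congr e1 (e1 ht)).differentiableWithinAt,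
      fun h => by simp at h, ?_⟩
    rw [contDiffOn_one_iff_derivWithin hs]
    refine ⟨fun t ht => ((h.hasDeriv_w t ht).congr e2 (e2 ht)).differentiableWithinAt, ?_⟩
    refine ContinuousOn.congr ?_ e3
    unfold forcing
    fun_prop
  · rw [i2, i3, e1 ht, e2 ht, e3 ht]
    simp only [forcing]
    ring
  · rw [e1 self_mem_Ici, h.u_zero]
  · refine h.u_tendsto.congr' ?_
    filter_upwards [eventually_ge_atTop 0] with t ht using (e1 ht).symm
  · have hanti : AntitoneOn u (Ici 0) := antitoneOn_of_hasDerivWithinAt_Ici (convex_Ici 0)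
      subset_rfl h.hasDeriv_u fun t ht => h.w_nonpos t (interior_subset ht)
    have ed : ∀ t ∈ interior (Ici (0 : ℝ)), HasDerivAt f (u t) t := fun t ht =>
      (h.hasDeriv_f t (interior_subset ht)).hasDerivAt (mem_interior_iff_mem_nhds.1 ht)
    refine AntitoneOn.concaveOn_of_deriv (convex_Ici 0) cf
      (fun t ht => (ed t ht).differentiableAt.differentiableWithinAt) ?_
    intro s hs t ht hst
    rw [(ed s hs).deriv, (ed t ht).deriv]
    exact hanti (interior_subset hs) (interior_subset ht) hst

/-! ### Qualitative properties of decreasing profiles -/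

/-- The properties of the nonlinearity on `[1, b]` that the theory uses. -/
structure IsForcing (φ : ℝ → ℝ) (b : ℝ) : Prop where
  one : φ 1 = 0
  pos : ∀ y, 1 < y → y ≤ b → 0 < φ y
  lipschitz : ∃ K, LipschitzOnWith K φ (Icc 1 b)

theorem IsForcing.nonneg {φ : ℝ → ℝ} {b : ℝ} (hφ : IsForcing φ b) {y : ℝ} (hy : y ∈ Icc 1 b) :
    0 ≤ φ y := by
  rcases hy.1.eq_or_lt with h | h
  · rw [← h, hφ.one]
  · exact (hφ.pos y h hy.2).le

theorem IsForcing.exists_le_mul {φ : ℝ → ℝ} {b : ℝ} (hφ : IsForcing φ b) :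
    ∃ C, 0 ≤ C ∧ ∀ y ∈ Icc 1 b, φ y ≤ C * (y - 1) := by
  obtain ⟨K, hK⟩ := hφ.lipschitz
  refine ⟨K, K.2, fun y hy => ?_⟩
  have := hK.dist_le_mul y hy 1 ⟨le_rfl, hy.1.trans hy.2⟩
  rw [Real.dist_eq, Real.dist_eq, hφ.one, sub_zero, abs_of_nonneg (sub_nonneg.2 hy.1)] at this
  exact (le_abs_self _).trans this

namespace IsDecreasingProfile

variable {κ : ℝ} {φ : ℝ → ℝ} {a b : ℝ} {f u w : ℝ → ℝ}

theorem continuousOn_f (h : IsDecreasingProfile κ φ a b f u w) : ContinuousOn f (Ici 0) :=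
  fun t ht => (h.hasDeriv_f t ht).continuousWithinAt

theorem continuousOn_u (h : IsDecreasingProfile κ φ a b f u w) : ContinuousOn u (Ici 0) :=
  fun t ht => (h.hasDeriv_u t ht).continuousWithinAt

theorem continuousOn_w (h : IsDecreasingProfile κ φ a b f u w) : ContinuousOn w (Ici 0) :=
  fun t ht => (h.hasDeriv_w t ht).continuousWithinAt

theorem antitoneOn_u (h : IsDecreasingProfile κ φ a b f u w) : AntitoneOn u (Ici 0) :=
  antitoneOn_of_hasDerivWithinAt_Ici (convex_Ici 0) subset_rfl h.hasDeriv_u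
    fun t ht => h.w_nonpos t (interior_subset ht)

theorem u_mem (h : IsDecreasingProfile κ φ a b f u w) {t : ℝ} (ht : 0 ≤ t) : u t ∈ Icc 1 b := by
  constructor
  · refine le_of_tendsto h.u_tendsto ?_
    filter_upwards [eventually_ge_atTop t] with s hs
    exact h.antitoneOn_u ht (ht.trans hs) hs
  · rw [← h.u_zero]
    exact h.antitoneOn_u self_mem_Ici ht ht

theorem hasDeriv_sub (h : IsDecreasingProfile κ φ a b f u w) (t : ℝ) (ht : 0 ≤ t) :
    HasDerivWithinAt (fun t => f t - t) (u t - 1) (Ici 0) t :=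
  (h.hasDeriv_f t ht).sub (hasDerivWithinAt_id t _)

theorem monotoneOn_sub (h : IsDecreasingProfile κ φ a b f u w) :
    MonotoneOn (fun t => f t - t) (Ici 0) :=
  monotoneOn_of_hasDerivWithinAt_Ici (convex_Ici 0) subset_rfl h.hasDeriv_sub
    fun _ ht => sub_nonneg.2 (h.u_mem (interior_subset ht)).1

theorem add_le_f (h : IsDecreasingProfile κ φ a b f u w) {t : ℝ} (ht : 0 ≤ t) : t + a ≤ f t := by
  have := h.monotoneOn_sub self_mem_Ici ht ht
  simp only [h.f_zero] at this
  linarith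

/-- The equilibrium u = 1, w = 0 cannot be reached in finite time. If u(t) = 1, then u is constant
from t on, so w(t) = 0. But (w² + (u-1)²) e^{Ks} is nondecreasing on [0, t], so it would vanish at 0
too, where u = b > 1. -/
theorem one_lt_u (h : IsDecreasingProfile κ φ a b f u w) (hφ : IsForcing φ b) (hb : 1 < b)
    {t : ℝ} (ht : 0 ≤ t) : 1 < u t := by
  refine (h.u_mem ht).1.lt_of_ne fun hut => ?_
  have hwt : w t = 0 := by
    refine le_antisymm (h.w_nonpos t ht) ?_
    have hd : HasDerivWithinAt u (w t) (Ici t) t := (h.hasDeriv_u t ht).mono (Ici_subset_Ici.2 ht)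
    have hc : HasDerivWithinAt u 0 (Ici t) t := by
      refine (hasDerivWithinAt_const t (Ici t) (1 : ℝ)).congr (fun s hs => ?_) hut.symm
      refine le_antisymm ?_ (h.u_mem (ht.trans hs)).1
      rw [hut]
      exact h.antitoneOn_u ht (ht.trans hs) hs
    exact ((uniqueDiffWithinAt_Ici t).eq_deriv _ hd hc).ge
  obtain ⟨F, hF⟩ := (isCompact_Icc (a := (0 : ℝ)) (b := t)).exists_bound_of_continuousOn
    (h.continuousOn_f.mono Icc_subset_Ici_self)
  obtain ⟨C, hC0, hC⟩ := hφ.exists_le_mul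
  -- The three summands absorb, in order, the terms -2κfw², 2wφ(u) and 2(u-1)w of the derivative of
  -- w² + (u-1)². The second uses w ≤ 0 and φ(u) ≤ C(u-1).
  set K := 2 * |κ| * F + C + 1 with hK
  have hder : ∀ s, 0 ≤ s → HasDerivWithinAt
      (fun s => (w s ^ 2 + (u s - 1) ^ 2) * Real.exp (K * s))
      ((2 * w s * (-κ * f s * w s + φ (u s)) + 2 * (u s - 1) * w s
        + K * (w s ^ 2 + (u s - 1) ^ 2)) * Real.exp (K * s)) (Ici 0) s := by
    intro s hs
    have h1 := ((h.hasDeriv_w s hs).pow 2).add (((h.hasDeriv_u s hs).sub_const 1).pow 2)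
    have h2 : HasDerivWithinAt (fun s => Real.exp (K * s)) (Real.exp (K * s) * (K * 1)) (Ici 0) s :=
      (((hasDerivWithinAt_id s (Ici 0)).const_mul K).exp)
    refine (h1.mul h2).congr_deriv ?_
    simp only [Pi.add_apply, Pi.pow_apply]
    ring
  have hmono := monotoneOn_of_hasDerivWithinAt_Ici (convex_Icc 0 t) Icc_subset_Ici_self hder
    (fun s hs => by
      have hs' := interior_subset hs
      refine mul_nonneg ?_ (Real.exp_pos _).le
      have hu := h.u_mem hs'.1
      have hw := h.w_nonpos s hs'.1
      have hf := hF s hs'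
      rw [Real.norm_eq_abs] at hf
      have hφu := hC _ hu
      have hφ0 := hφ.nonneg hu
      have h1 : κ * f s ≤ |κ| * F := (le_abs_self _).trans
        ((abs_mul κ (f s)).le.trans (mul_le_mul_of_nonneg_left hf (abs_nonneg κ)))
      have h2 : κ * f s * w s ^ 2 ≤ |κ| * F * w s ^ 2 := mul_le_mul_of_nonneg_right h1 (sq_nonneg _)
      have h3 : w s * (C * (u s - 1)) ≤ w s * φ (u s) := mul_le_mul_of_nonpos_left hφu hw
      have h4 : 0 ≤ C * (w s + (u s - 1)) ^ 2 := by positivity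
      have h5 : 0 ≤ (w s + (u s - 1)) ^ 2 := sq_nonneg _
      have h6 : 0 ≤ |κ| * F * (u s - 1) ^ 2 :=
        mul_nonneg (mul_nonneg (abs_nonneg _) ((abs_nonneg _).trans hf)) (sq_nonneg _)
      rw [hK]
      linarith)
  have := hmono ⟨le_rfl, ht⟩ ⟨ht, le_rfl⟩ ht
  simp only [hwt, ← hut, h.u_zero, mul_zero, Real.exp_zero] at this
  nlinarith [sq_nonneg (w 0), mul_pos (sub_pos.2 hb) (sub_pos.2 hb)]

/-- A zero of w would be a maximum, forcing w' ≤ 0, while there w' = φ(u) > 0. -/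
theorem w_neg (h : IsDecreasingProfile κ φ a b f u w) (hφ : IsForcing φ b) (hb : 1 < b)
    {t : ℝ} (ht : 0 ≤ t) : w t < 0 := by
  refine (h.w_nonpos t ht).lt_of_ne fun hwt => ?_
  have hpos := hφ.pos _ (h.one_lt_u hφ hb ht) (h.u_mem ht).2
  have hd := deriv_nonpos_of_isMaxOn_right ht (h.hasDeriv_w t ht) fun s hs =>
    (h.w_nonpos s (ht.trans hs)).trans hwt.ge
  rw [hwt, mul_zero, zero_add] at hd
  exact hd.not_gt hpos

/-- Exponential convergence of `w` and `u` to their limits. -/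
theorem exists_exp_bound (h : IsDecreasingProfile κ φ a b f u w) (hκ : 0 < κ)
    (hφ : IsForcing φ b) : ∃ s C, 0 ≤ s ∧ 0 ≤ C ∧
      ∀ t, s ≤ t → -(C * Real.exp (-t)) ≤ w t ∧ u t - 1 ≤ C * Real.exp (-t) := by
  -- Since f ≥ t + a, past s one has κ f ≥ 1, which makes w e^t nondecreasing.
  set s := max 0 (1 / κ - a)
  have hs0 : 0 ≤ s := le_max_left _ _
  have hIci : Ici s ⊆ Ici 0 := Ici_subset_Ici.2 hs0
  have hder : ∀ t, 0 ≤ t → HasDerivWithinAt (fun t => w t * Real.exp t)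
      ((-κ * f t * w t + φ (u t) + w t) * Real.exp t) (Ici 0) t := fun t ht => by
    refine ((h.hasDeriv_w t ht).mul (Real.hasDerivAt_exp t).hasDerivWithinAt).congr_deriv ?_
    ring
  have hmono := monotoneOn_of_hasDerivWithinAt_Ici (convex_Ici s) hIci hder fun t ht => by
    have hts : s ≤ t := interior_subset ht
    have ht0 : 0 ≤ t := hs0.trans hts
    refine mul_nonneg ?_ (Real.exp_pos _).le
    have h1 : 1 ≤ κ * f t := by
      have := h.add_le_f ht0
      have h2 : 1 / κ - a ≤ t := (le_max_right _ _).trans hts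
      rw [mul_comm, ← div_le_iff₀ hκ]
      linarith
    have h2 := h.w_nonpos t ht0
    have h3 := hφ.nonneg (h.u_mem ht0)
    nlinarith
  have hw : ∀ t, s ≤ t → -(-(w s * Real.exp s) * Real.exp (-t)) ≤ w t := fun t ht => by
    have h1 := hmono self_mem_Ici ht ht
    simp only at h1
    have h2 := mul_le_mul_of_nonneg_right h1 (Real.exp_pos (-t)).le
    rw [mul_assoc (w t), ← Real.exp_add, add_neg_cancel, Real.exp_zero, mul_one] at h2
    linarith
  refine ⟨s, -(w s * Real.exp s), hs0, ?_, fun t ht => ⟨hw t ht, ?_⟩⟩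
  · have := mul_nonneg (neg_nonneg.2 (h.w_nonpos s hs0)) (Real.exp_pos s).le
    linarith
  · set C := -(w s * Real.exp s)
    -- By the bound on w, u - C e^{-t} is nondecreasing past s; its limit is 1, so it stays at most
    -- 1.
    have hder2 : ∀ t, 0 ≤ t → HasDerivWithinAt (fun t => u t - C * Real.exp (-t))
        (w t + C * Real.exp (-t)) (Ici 0) t := fun t ht => by
      have h1 : HasDerivWithinAt (fun t => Real.exp (-t)) (Real.exp (-t) * -1) (Ici 0) t :=
        ((hasDerivWithinAt_id t (Ici 0)).neg).exp
      refine ((h.hasDeriv_u t ht).sub (h1.const_mul C)).congr_deriv ?_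
      ring
    have hmono2 := monotoneOn_of_hasDerivWithinAt_Ici (convex_Ici s) hIci hder2 fun t ht => by
      have := hw t (interior_subset ht)
      linarith
    have hlim : Tendsto (fun t => u t - C * Real.exp (-t)) atTop (𝓝 (1 - C * 0)) :=
      h.u_tendsto.sub ((Real.tendsto_exp_neg_atTop_nhds_zero).const_mul C)
    have := ge_of_tendsto hlim (b := u t - C * Real.exp (-t)) (by
      filter_upwards [eventually_ge_atTop t] with r hr
      exact hmono2 ht (ht.trans hr) hr)
    linarith

theorem w_tendsto (h : IsDecreasingProfile κ φ a b f u w) (hκ : 0 < κ)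
    (hφ : IsForcing φ b) : Tendsto w atTop (𝓝 0) := by
  obtain ⟨s, C, hs, -, hC⟩ := h.exists_exp_bound hκ hφ
  have hlim : Tendsto (fun t => -(C * Real.exp (-t))) atTop (𝓝 0) := by
    simpa using ((Real.tendsto_exp_neg_atTop_nhds_zero).const_mul C).neg
  refine tendsto_of_tendsto_of_tendsto_of_le_of_le' hlim tendsto_const_nhds ?_ ?_
  · filter_upwards [eventually_ge_atTop s] with t ht using (hC t ht).1
  · filter_upwards [eventually_ge_atTop 0] with t ht using h.w_nonpos t ht

theorem exists_sub_le (h : IsDecreasingProfile κ φ a b f u w) (hκ : 0 < κ)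
    (hφ : IsForcing φ b) : ∃ D, ∀ t, 0 ≤ t → f t - t ≤ D := by
  obtain ⟨s, C, hs, hC0, hC⟩ := h.exists_exp_bound hκ hφ
  have hder : ∀ t, 0 ≤ t → HasDerivWithinAt (fun t => f t - t + C * Real.exp (-t))
      (u t - 1 - C * Real.exp (-t)) (Ici 0) t := fun t ht => by
    have h1 : HasDerivWithinAt (fun t => Real.exp (-t)) (Real.exp (-t) * -1) (Ici 0) t :=
      ((hasDerivWithinAt_id t (Ici 0)).neg).exp
    refine ((h.hasDeriv_sub t ht).add (h1.const_mul C)).congr_deriv ?_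
    ring
  have hanti := antitoneOn_of_hasDerivWithinAt_Ici (convex_Ici s) (Ici_subset_Ici.2 hs) hder
    fun t ht => by linarith [(hC t (interior_subset ht)).2]
  refine ⟨f s - s + C * Real.exp (-s), fun t ht => ?_⟩
  have h1 := h.monotoneOn_sub ht (hs.trans (le_max_left s t)) (le_max_right s t)
  have h2 := hanti self_mem_Ici (le_max_left s t) (le_max_left s t)
  have h3 : 0 ≤ C * Real.exp (-(max s t)) := mul_nonneg hC0 (Real.exp_pos _).le
  simp only at h1 h2
  linarith

theorem exists_tendsto_sub (h : IsDecreasingProfile κ φ a b f u w) (hκ : 0 < κ)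
    (hφ : IsForcing φ b) : ∃ l, Tendsto (fun t => f t - t) atTop (𝓝 l) := by
  obtain ⟨D, hD⟩ := h.exists_sub_le hκ hφ
  have hm : Monotone fun t => f (max 0 t) - max 0 t := fun s t hst =>
    h.monotoneOn_sub (le_max_left 0 s) (le_max_left 0 t) (max_le_max le_rfl hst)
  have hb : BddAbove (range fun t => f (max 0 t) - max 0 t) :=
    ⟨D, by rintro _ ⟨t, rfl⟩; exact hD _ (le_max_left 0 t)⟩
  refine ⟨_, (tendsto_atTop_ciSup hm hb).congr' ?_⟩
  filter_upwards [eventually_ge_atTop 0] with t ht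
  rw [max_eq_right ht]

/-- The terms in f w cancel in the derivative, leaving φ(u) + κ u (u-1) ≥ 0. So it suffices that the
quantity is eventually below something tending to 0: w ≤ 0, and f grows at most linearly while u - 1
decays exponentially. -/
theorem w_add_nonpos (h : IsDecreasingProfile κ φ a b f u w) (hκ : 0 < κ)
    (hφ : IsForcing φ b) {t : ℝ} (ht : 0 ≤ t) : w t + κ * f t * (u t - 1) ≤ 0 := by
  obtain ⟨s, C, hs, hC0, hC⟩ := h.exists_exp_bound hκ hφ
  obtain ⟨D, hD⟩ := h.exists_sub_le hκ hφ
  have hder : ∀ t, 0 ≤ t → HasDerivWithinAt (fun t => w t + κ * f t * (u t - 1))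
      (φ (u t) + κ * u t * (u t - 1)) (Ici 0) t := fun t ht => by
    refine ((h.hasDeriv_w t ht).add (((h.hasDeriv_f t ht).const_mul κ).mul
      ((h.hasDeriv_u t ht).sub_const 1))).congr_deriv ?_
    ring
  have hmono := monotoneOn_of_hasDerivWithinAt_Ici (convex_Ici 0) subset_rfl hder fun t ht => by
    have hu := h.u_mem (interior_subset ht)
    have := hφ.nonneg hu
    have h1 : 0 ≤ u t - 1 := sub_nonneg.2 hu.1
    have h2 : 0 ≤ u t := by linarith
    positivity
  have hlim : Tendsto (fun t : ℝ => κ * C * (t * Real.exp (-t) + D * Real.exp (-t)))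
      atTop (𝓝 (κ * C * (0 + D * 0))) := by
    have h1 : Tendsto (fun t : ℝ => t * Real.exp (-t)) atTop (𝓝 0) := by
      simpa using Real.tendsto_pow_mul_exp_neg_atTop_nhds_zero 1
    exact (h1.add (Real.tendsto_exp_neg_atTop_nhds_zero.const_mul D)).const_mul _
  rw [mul_zero, add_zero, mul_zero] at hlim
  refine ge_of_tendsto hlim ?_
  filter_upwards [eventually_ge_atTop s, eventually_ge_atTop t, eventually_ge_atTop (-a)]
    with r hrs hrt hra
  have hr0 : 0 ≤ r := hs.trans hrs
  refine (hmono ht hr0 hrt).trans ?_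
  have h1 := h.w_nonpos r hr0
  have hf0 : 0 ≤ f r := by linarith [h.add_le_f hr0]
  have h2 : f r * (u r - 1) ≤ (r + D) * (C * Real.exp (-r)) :=
    mul_le_mul (by linarith [hD r hr0]) (hC r hrs).2 (sub_nonneg.2 (h.u_mem hr0).1)
      (by linarith [hD r hr0])
  have h3 := mul_le_mul_of_nonneg_left h2 hκ.le
  simp only
  linarith

/-- The asymptote `t + l` of a decreasing profile. -/
theorem exists_asymptote (h : IsDecreasingProfile κ φ a b f u w) (hκ : 0 < κ)
    (hφ : IsForcing φ b) (hb : 1 < b) :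
    ∃ l, a < l ∧ l ^ 2 < a ^ 2 + 2 * (b - 1) / κ ∧
      Tendsto (fun t => f t - (t + l)) atTop (𝓝 0) ∧
      ∀ t, 0 ≤ t → t + a ≤ f t ∧ f t ≤ t + l := by
  obtain ⟨l, hl⟩ := h.exists_tendsto_sub hκ hφ
  have hle : ∀ t, 0 ≤ t → f t - t ≤ l := fun t ht => by
    refine ge_of_tendsto hl ?_
    filter_upwards [eventually_ge_atTop t] with s hs
    exact h.monotoneOn_sub ht (ht.trans hs) hs
  refine ⟨l, ?_, ?_, ?_, fun t ht => ⟨h.add_le_f ht, by linarith [hle t ht]⟩⟩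
  · have := strictMonoOn_of_hasDerivWithinAt_Ici (convex_Ici 0) subset_rfl h.hasDeriv_sub
      (fun t ht => sub_pos.2 (h.one_lt_u hφ hb (interior_subset ht))) self_mem_Ici
      (mem_Ici.2 zero_le_one) zero_lt_one
    simp only [h.f_zero] at this
    linarith [hle 1 zero_le_one]
  -- The derivative equals (w + κ f (u-1)) - κ t (u-1), negative for t > 0 by `w_add_nonpos`.
  -- Comparing first 0 with 1, then 1 with infinity, keeps the inequality strict in the limit.
  · have hder : ∀ t, 0 ≤ t → HasDerivWithinAt (fun t => u t + κ / 2 * (f t - t) ^ 2)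
        (w t + κ * (f t - t) * (u t - 1)) (Ici 0) t := fun t ht => by
      refine ((h.hasDeriv_u t ht).add
        (((h.hasDeriv_sub t ht).pow 2).const_mul (κ / 2))).congr_deriv ?_
      norm_num
      ring
    have hanti := strictAntiOn_of_hasDerivWithinAt_Ici (convex_Ici 0) subset_rfl hder fun t ht => by
      have ht' : 0 < t := by simpa using ht
      have h1 := h.w_add_nonpos hκ hφ ht'.le
      have h2 := mul_pos (mul_pos hκ ht') (sub_pos.2 (h.one_lt_u hφ hb ht'.le))
      linarith
    have hlim : Tendsto (fun t => u t + κ / 2 * (f t - t) ^ 2) atTop (𝓝 (1 + κ / 2 * l ^ 2)) :=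
      h.u_tendsto.add ((hl.pow 2).const_mul _)
    have h1 := le_of_tendsto hlim (b := u 1 + κ / 2 * (f 1 - 1) ^ 2) (by
      filter_upwards [eventually_ge_atTop 1] with t ht
      exact hanti.antitoneOn (mem_Ici.2 zero_le_one) (mem_Ici.2 (zero_le_one.trans ht)) ht)
    have h2 := hanti self_mem_Ici (mem_Ici.2 zero_le_one) zero_lt_one
    simp only [h.u_zero, h.f_zero] at h2
    have h3 : κ * (l ^ 2 - a ^ 2) < 2 * (b - 1) := by nlinarith
    have h4 : l ^ 2 - a ^ 2 < 2 * (b - 1) / κ := by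
      rw [lt_div_iff₀ hκ]
      linarith
    linarith
  · have := hl.sub_const l
    rw [sub_self] at this
    refine this.congr fun t => ?_
    ring

end IsDecreasingProfile

/-! ### The clamped system -/

/-- Truncation of a real number to `[lo, hi]`. -/
def clamp (lo hi x : ℝ) : ℝ := max lo (min hi x)

theorem lipschitzWith_clamp (lo hi : ℝ) : LipschitzWith 1 (clamp lo hi) :=
  (LipschitzWith.id.const_min hi).const_max lo

theorem clamp_mem {lo hi : ℝ} (h : lo ≤ hi) (x : ℝ) : clamp lo hi x ∈ Icc lo hi :=
  ⟨le_max_left _ _, max_le h (min_le_left _ _)⟩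

theorem clamp_of_mem {lo hi x : ℝ} (h : x ∈ Icc lo hi) : clamp lo hi x = x := by
  rw [clamp, min_eq_right h.2, max_eq_right h.1]

theorem clamp_eq_left {lo hi x : ℝ} (h : lo ≤ hi) (hx : x ≤ lo) : clamp lo hi x = lo := by
  rw [clamp, min_eq_right (hx.trans h), max_eq_left hx]

theorem abs_clamp_le_abs {R : ℝ} (hR : 0 ≤ R) (x : ℝ) : |clamp (-R) R x| ≤ |x| := by
  unfold clamp
  rcases le_total R x with h | h
  · rw [min_eq_left h, max_eq_right (by linarith), abs_of_nonneg hR]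
    exact h.trans (le_abs_self x)
  · rw [min_eq_right h]
    rcases le_total (-R) x with h' | h'
    · rw [max_eq_right h']
    · rw [max_eq_left h', abs_neg, abs_of_nonneg hR]
      exact (le_neg_of_le_neg h').trans (neg_le_abs x)

theorem abs_clamp_le {R : ℝ} (hR : 0 ≤ R) (x : ℝ) : |clamp (-R) R x| ≤ R :=
  abs_le.2 (clamp_mem (by linarith) x)

theorem clamp_of_abs_le {R x : ℝ} (h : |x| ≤ R) : clamp (-R) R x = x :=
  clamp_of_mem (abs_le.1 h)

/-- Trajectories on `D` of the system `f' = u`, `u' = w`, `w' = -κ f w + φ(u)` in which `u` is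
replaced by its truncation to `[1, b]` on the right-hand sides of the first and third equation. -/
structure IsClampedTrajectory (κ : ℝ) (φ : ℝ → ℝ) (b : ℝ) (D : Set ℝ) (f u w : ℝ → ℝ) : Prop where
  hasDeriv_f : ∀ t ∈ D, HasDerivWithinAt f (clamp 1 b (u t)) D t
  hasDeriv_u : ∀ t ∈ D, HasDerivWithinAt u (w t) D t
  hasDeriv_w : ∀ t ∈ D, HasDerivWithinAt w (-κ * f t * w t + φ (clamp 1 b (u t))) D t

theorem IsClampedTrajectory.mono {κ : ℝ} {φ : ℝ → ℝ} {b : ℝ} {D D₂ : Set ℝ} {f u w : ℝ → ℝ}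
    (h : IsClampedTrajectory κ φ b D f u w) (hD : D₂ ⊆ D) :
    IsClampedTrajectory κ φ b D₂ f u w :=
  ⟨fun t ht => (h.hasDeriv_f t (hD ht)).mono hD, fun t ht => (h.hasDeriv_u t (hD ht)).mono hD,
    fun t ht => (h.hasDeriv_w t (hD ht)).mono hD⟩

theorem IsDecreasingProfile.isClampedTrajectory {κ : ℝ} {φ : ℝ → ℝ} {a b : ℝ} {f u w : ℝ → ℝ}
    (h : IsDecreasingProfile κ φ a b f u w) : IsClampedTrajectory κ φ b (Ici 0) f u w := by
  refine ⟨fun t ht => ?_, h.hasDeriv_u, fun t ht => ?_⟩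
  · rw [clamp_of_mem (h.u_mem ht)]
    exact h.hasDeriv_f t ht
  · rw [clamp_of_mem (h.u_mem ht)]
    exact h.hasDeriv_w t ht

/-- The clamped vector field, truncated further to make it bounded and globally Lipschitz. -/
def truncatedField (κ : ℝ) (φ : ℝ → ℝ) (b R : ℝ) (x : ℝ × ℝ × ℝ) : ℝ × ℝ × ℝ :=
  (clamp 1 b x.2.1, clamp (-R) R x.2.2,
    -κ * clamp (-R) R x.1 * clamp (-R) R x.2.2 + φ (clamp 1 b x.2.1))

theorem exists_lipschitzWith_truncatedField (κ : ℝ) {φ : ℝ → ℝ} {b R : ℝ} (hb : 1 < b)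
    (hR : 0 ≤ R) (hφ : IsForcing φ b) : ∃ K, LipschitzWith K (truncatedField κ φ b R) := by
  obtain ⟨K, hK⟩ := hφ.lipschitz
  have l1 : LipschitzWith 1 fun x : ℝ × ℝ × ℝ => x.1 := LipschitzWith.prod_fst
  have l2 : LipschitzWith (1 * 1) fun x : ℝ × ℝ × ℝ => x.2.1 :=
    LipschitzWith.prod_fst.comp LipschitzWith.prod_snd
  have l3 : LipschitzWith (1 * 1) fun x : ℝ × ℝ × ℝ => x.2.2 :=
    LipschitzWith.prod_snd.comp LipschitzWith.prod_snd
  have c1 := (lipschitzWith_clamp (-R) R).comp l1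
  have c2 := (lipschitzWith_clamp 1 b).comp l2
  have c3 := (lipschitzWith_clamp (-R) R).comp l3
  have hprod : LipschitzWith (Real.toNNReal (|κ| * R + |κ| * R)) fun x : ℝ × ℝ × ℝ =>
      -κ * clamp (-R) R x.1 * clamp (-R) R x.2.2 := by
    refine LipschitzWith.of_dist_le' fun x y => ?_
    have d1 := c1.dist_le_mul x y
    have d3 := c3.dist_le_mul x y
    simp only [Function.comp, mul_one, NNReal.coe_one, one_mul, Real.dist_eq] at d1 d3
    rw [Real.dist_eq, show -κ * clamp (-R) R x.1 * clamp (-R) R x.2.2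
        - -κ * clamp (-R) R y.1 * clamp (-R) R y.2.2
      = -κ * ((clamp (-R) R x.1 - clamp (-R) R y.1) * clamp (-R) R x.2.2
        + clamp (-R) R y.1 * (clamp (-R) R x.2.2 - clamp (-R) R y.2.2)) by ring, abs_mul, abs_neg]
    have h1 : |(clamp (-R) R x.1 - clamp (-R) R y.1) * clamp (-R) R x.2.2| ≤ dist x y * R := by
      rw [abs_mul]
      exact mul_le_mul d1 (abs_clamp_le hR _) (abs_nonneg _) dist_nonneg
    have h2 : |clamp (-R) R y.1 * (clamp (-R) R x.2.2 - clamp (-R) R y.2.2)| ≤ R * dist x y := by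
      rw [abs_mul]
      exact mul_le_mul (abs_clamp_le hR _) d3 (abs_nonneg _) hR
    calc _ ≤ |κ| * (dist x y * R + R * dist x y) :=
          mul_le_mul_of_nonneg_left ((abs_add_le _ _).trans (add_le_add h1 h2)) (abs_nonneg _)
      _ = _ := by ring
  have hφc : LipschitzWith (K * (1 * (1 * 1))) fun x : ℝ × ℝ × ℝ => φ (clamp 1 b x.2.1) := by
    rw [← lipschitzOnWith_univ] at c2 ⊢
    exact hK.comp c2 fun x _ => clamp_mem hb.le _
  exact ⟨_, c2.prodMk (c3.prodMk (hprod.add hφc))⟩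

/-- A priori bound for the clamped and for the truncated system. -/
theorem exists_apriori_bound (κ : ℝ) {φ : ℝ → ℝ} {b : ℝ} (a C T : ℝ) (hb : 1 < b) (hC : 0 ≤ C)
    (hφ : IsForcing φ b) : ∃ R, 0 ≤ R ∧ ∀ f g w d : ℝ → ℝ, f 0 = a → |w 0| ≤ C →
      (∀ t ∈ Icc 0 T, HasDerivWithinAt f (g t) (Icc 0 T) t) →
      (∀ t ∈ Icc 0 T, HasDerivWithinAt w (d t) (Icc 0 T) t) →
      (∀ t ∈ Icc 0 T, g t ∈ Icc 1 b) →
      (∀ t ∈ Icc 0 T, |d t| ≤ |κ| * |f t| * |w t| + φ (g t)) →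
      ∀ t ∈ Icc 0 T, |f t| ≤ R ∧ |w t| ≤ R := by
  obtain ⟨L, hL0, hL⟩ := hφ.exists_le_mul
  -- The bound on f comes from 1 ≤ f' ≤ b, the one on w from Grönwall with φ ≤ L(b-1). The outer
  -- maximum covers negative T.
  refine ⟨max 0 (max (|a| + b * T) (gronwallBound C (|κ| * (|a| + b * T)) (L * (b - 1)) T)),
    le_max_left _ _, fun f g w d hf0 hw0 hf hw hg hd => ?_⟩
  have hbf : ∀ t ∈ Icc 0 T, |f t| ≤ |a| + b * T := fun t ht => by
    have h1 := norm_image_sub_le_of_norm_deriv_le_segment' hf (C := b) (fun s hs => by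
      have := hg s (Ico_subset_Icc_self hs)
      rw [Real.norm_eq_abs, abs_of_nonneg (by linarith [this.1])]
      exact this.2) t ht
    rw [hf0, Real.norm_eq_abs, sub_zero] at h1
    have h2 : |f t| ≤ |f t - a| + |a| := by
      have := abs_add_le (f t - a) a
      rwa [sub_add_cancel] at this
    have h3 : b * t ≤ b * T := mul_le_mul_of_nonneg_left ht.2 (by linarith)
    linarith
  have hbw : ∀ t ∈ Icc 0 T, |w t| ≤ gronwallBound C (|κ| * (|a| + b * T)) (L * (b - 1)) T := by
    intro t ht
    have hT : 0 ≤ T := ht.1.trans ht.2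
    have h1 := norm_le_gronwallBound_of_norm_deriv_right_le (f := w) (f' := d) (δ := C)
      (K := |κ| * (|a| + b * T)) (ε := L * (b - 1)) (a := 0) (b := T)
      (fun s hs => (hw s hs).continuousWithinAt)
      (fun s hs => (hw s (Ico_subset_Icc_self hs)).mono_of_mem_nhdsWithin
        (Icc_mem_nhdsGE_of_mem hs)) hw0
      (fun s hs => by
        have hs' := Ico_subset_Icc_self hs
        have h2 := hL _ (hg s hs')
        have h3 : L * (g s - 1) ≤ L * (b - 1) :=
          mul_le_mul_of_nonneg_left (by linarith [(hg s hs').2]) hL0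
        have h4 : |κ| * |f s| * |w s| ≤ |κ| * (|a| + b * T) * |w s| :=
          mul_le_mul_of_nonneg_right
            (mul_le_mul_of_nonneg_left (hbf s hs') (abs_nonneg _)) (abs_nonneg _)
        simp only [Real.norm_eq_abs]
        linarith [hd s hs']) t ht
    rw [sub_zero] at h1
    refine h1.trans (gronwallBound_mono hC (mul_nonneg hL0 (by linarith)) ?_ ht.2)
    have : 0 ≤ b * T := mul_nonneg (by linarith) hT
    positivity
  exact fun t ht => ⟨(hbf t ht).trans ((le_max_left _ _).trans (le_max_right _ _)),
    (hbw t ht).trans ((le_max_right _ _).trans (le_max_right _ _))⟩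

theorem abs_clamped_rhs_le {κ : ℝ} {φ : ℝ → ℝ} {b : ℝ} (hb : 1 < b)
    (hφ : IsForcing φ b) (x y z : ℝ) :
    |-κ * x * z + φ (clamp 1 b y)| ≤ |κ| * |x| * |z| + φ (clamp 1 b y) := by
  have := abs_add_le (-κ * x * z) (φ (clamp 1 b y))
  rwa [abs_mul, abs_mul, abs_neg, abs_of_nonneg (hφ.nonneg (clamp_mem hb.le y))] at this

/-- Lipschitz dependence on the initial value of `w`, uniformly on bounded sets. -/
theorem exists_dist_clampedTrajectory_le (κ : ℝ) {φ : ℝ → ℝ} {b : ℝ} (a C T : ℝ) (hb : 1 < b)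
    (hC : 0 ≤ C) (hφ : IsForcing φ b) : ∃ K : ℝ, ∀ f₁ u₁ w₁ f₂ u₂ w₂ : ℝ → ℝ,
      IsClampedTrajectory κ φ b (Icc 0 T) f₁ u₁ w₁ →
      IsClampedTrajectory κ φ b (Icc 0 T) f₂ u₂ w₂ →
      f₁ 0 = a → f₂ 0 = a → u₁ 0 = b → u₂ 0 = b → |w₁ 0| ≤ C → |w₂ 0| ≤ C →
      ∀ t ∈ Icc 0 T, |f₁ t - f₂ t| ≤ |w₁ 0 - w₂ 0| * K ∧ |u₁ t - u₂ t| ≤ |w₁ 0 - w₂ 0| * K ∧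
        |w₁ t - w₂ t| ≤ |w₁ 0 - w₂ 0| * K := by
  obtain ⟨R, hR0, hR⟩ := exists_apriori_bound κ a C T hb hC hφ
  obtain ⟨K, hK⟩ := exists_lipschitzWith_truncatedField κ hb hR0 hφ
  refine ⟨Real.exp (K * T), fun f₁ u₁ w₁ f₂ u₂ w₂ h₁ h₂ hf₁ hf₂ hu₁ hu₂ hw₁ hw₂ t ht => ?_⟩
  -- Within the a priori bound R the truncation is inactive, so clamped trajectories also solve a
  -- globally Lipschitz system.
  have key : ∀ f u w : ℝ → ℝ, IsClampedTrajectory κ φ b (Icc 0 T) f u w → f 0 = a → |w 0| ≤ C →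
      ∀ t ∈ Icc 0 T, HasDerivWithinAt (fun t => (f t, u t, w t))
        (truncatedField κ φ b R (f t, u t, w t)) (Icc 0 T) t := by
    intro f u w h hf hw t ht
    obtain ⟨r1, r2⟩ := hR f (fun t => clamp 1 b (u t)) w _ hf hw h.hasDeriv_f h.hasDeriv_w
      (fun t _ => clamp_mem hb.le _)
      (fun t _ => abs_clamped_rhs_le hb hφ _ _ _) t ht
    simp only [truncatedField, clamp_of_abs_le r1, clamp_of_abs_le r2]
    exact (h.hasDeriv_f t ht).prodMk ((h.hasDeriv_u t ht).prodMk (h.hasDeriv_w t ht))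
  have k1 := key f₁ u₁ w₁ h₁ hf₁ hw₁
  have k2 := key f₂ u₂ w₂ h₂ hf₂ hw₂
  have hd := dist_le_of_trajectories_ODE (v := fun _ => truncatedField κ φ b R) (K := K)
    (f := fun t => (f₁ t, u₁ t, w₁ t)) (g := fun t => (f₂ t, u₂ t, w₂ t)) (a := 0) (b := T)
    (δ := |w₁ 0 - w₂ 0|) (fun _ => hK)
    (fun s hs => (k1 s hs).continuousWithinAt)
    (fun s hs => (k1 s (Ico_subset_Icc_self hs)).mono_of_mem_nhdsWithin
      (Icc_mem_nhdsGE_of_mem hs))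
    (fun s hs => (k2 s hs).continuousWithinAt)
    (fun s hs => (k2 s (Ico_subset_Icc_self hs)).mono_of_mem_nhdsWithin
      (Icc_mem_nhdsGE_of_mem hs))
    (by simp [Prod.dist_eq, hf₁, hf₂, hu₁, hu₂, Real.dist_eq]) t ht
  have hd' : dist (f₁ t, u₁ t, w₁ t) (f₂ t, u₂ t, w₂ t) ≤ |w₁ 0 - w₂ 0| * Real.exp (K * T) := by
    refine hd.trans (mul_le_mul_of_nonneg_left (Real.exp_le_exp.2 ?_) (abs_nonneg _))
    rw [sub_zero]
    exact mul_le_mul_of_nonneg_left ht.2 K.2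
  simpa only [Prod.dist_eq, Real.dist_eq, max_le_iff] using hd'

theorem IsClampedTrajectory.eqOn {κ : ℝ} {φ : ℝ → ℝ} {b T : ℝ} {f₁ u₁ w₁ f₂ u₂ w₂ : ℝ → ℝ}
    (h₁ : IsClampedTrajectory κ φ b (Icc 0 T) f₁ u₁ w₁)
    (h₂ : IsClampedTrajectory κ φ b (Icc 0 T) f₂ u₂ w₂) (hb : 1 < b) (hφ : IsForcing φ b)
    (hf : f₁ 0 = f₂ 0) (hu₁ : u₁ 0 = b) (hu₂ : u₂ 0 = b) (hw : w₁ 0 = w₂ 0) :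
    ∀ t ∈ Icc 0 T, f₁ t = f₂ t ∧ u₁ t = u₂ t ∧ w₁ t = w₂ t := by
  obtain ⟨K, hK⟩ :=
    exists_dist_clampedTrajectory_le κ (f₂ 0) |w₂ 0| T hb (abs_nonneg _) hφ
  intro t ht
  have := hK f₁ u₁ w₁ f₂ u₂ w₂ h₁ h₂ hf rfl hu₁ hu₂ (by rw [hw]) le_rfl t ht
  simp only [hw, sub_self, abs_zero, zero_mul, abs_nonpos_iff, sub_eq_zero] at this
  exact this

/-! ### Uniqueness -/

namespace IsDecreasingProfile

variable {κ : ℝ} {φ : ℝ → ℝ} {a b : ℝ} {f u w : ℝ → ℝ}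

theorem exists_u_eq (h : IsDecreasingProfile κ φ a b f u w) {y : ℝ} (hy : y ∈ Ioc 1 b) :
    ∃ t ∈ Ici (0 : ℝ), u t = y := by
  obtain ⟨s, hs0, hs⟩ := ((eventually_ge_atTop (0 : ℝ)).and
    (h.u_tendsto.eventually (gt_mem_nhds hy.1))).exists
  obtain ⟨t, ht, rfl⟩ := intermediate_value_Icc' hs0 (h.continuousOn_u.mono Icc_subset_Ici_self)
    ⟨hs.le, h.u_zero ▸ hy.2⟩
  exact ⟨t, ht.1, rfl⟩

/-- Using `u` as the independent variable (Crocco's transformation), `f = v(u)` and `-w = p(u)`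
solve a first-order system on `(1, b]`. -/
theorem exists_crocco (h : IsDecreasingProfile κ φ a b f u w) (hκ : 0 < κ) (hφ : IsForcing φ b)
    (hb : 1 < b) : ∃ v p : ℝ → ℝ, v b = a ∧ p b = -w 0 ∧ (∀ y ∈ Ioc 1 b, 0 < p y) ∧
      ContinuousOn v (Ioc 1 b) ∧ ContinuousOn p (Ioc 1 b) ∧
      (∀ y ∈ Ioo 1 b, HasDerivAt v (-y / p y) y) ∧
      (∀ y ∈ Ioo 1 b, HasDerivAt p (κ * v y + φ y / p y) y) ∧
      ∀ ε > 0, ∃ y ∈ Ioc 1 b, p y < ε := by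
  have hanti : StrictAntiOn u (Ici 0) := strictAntiOn_of_hasDerivWithinAt_Ici (convex_Ici 0)
    subset_rfl h.hasDeriv_u fun t ht => h.w_neg hφ hb (interior_subset ht)
  set T := Function.invFunOn u (Ici 0)
  have hT0 : ∀ y ∈ Ioc 1 b, T y ∈ Ici (0 : ℝ) := fun y hy =>
    Function.invFunOn_mem (h.exists_u_eq hy)
  have huT : ∀ y ∈ Ioc 1 b, u (T y) = y := fun y hy => Function.invFunOn_eq (h.exists_u_eq hy)
  have hu_mem : ∀ t ∈ Ici (0 : ℝ), u t ∈ Ioc 1 b := fun t ht =>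
    ⟨h.one_lt_u hφ hb ht, (h.u_mem ht).2⟩
  have hTu : ∀ t ∈ Ici (0 : ℝ), T (u t) = t := fun t ht =>
    hanti.injOn (hT0 _ (hu_mem t ht)) ht (huT _ (hu_mem t ht))
  have hTb : T b = 0 := by rw [← h.u_zero]; exact hTu 0 self_mem_Ici
  have hTpos : ∀ y ∈ Ioo 1 b, 0 < T y := fun y hy => by
    have hy' := Ioo_subset_Ioc_self hy
    refine lt_of_le_of_ne (hT0 y hy') fun h0 => ?_
    have := huT y hy'
    rw [← h0, h.u_zero] at this
    exact hy.2.ne' this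
  have hTmono : MonotoneOn (fun y => -T y) (Ioc 1 b) := fun y hy z hz hyz => by
    refine neg_le_neg (not_lt.1 fun hlt => ?_)
    have := hanti (hT0 y hy) (hT0 z hz) hlt
    rw [huT y hy, huT z hz] at this
    exact this.not_ge hyz
  -- A monotone function whose image has no gaps is continuous. The sign turns the decreasing
  -- inverse T of u into a monotone function.
  have himage : Iic 0 ⊆ image (fun y => -T y) (Ioc 1 b) := fun s hs => by
    have hs' : -s ∈ Ici (0 : ℝ) := neg_nonneg.2 (mem_Iic.1 hs)
    exact ⟨u (-s), hu_mem _ hs', by simp only [hTu (-s) hs', neg_neg]⟩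
  have hTcont : ∀ y ∈ Ioo 1 b, ContinuousAt T y := fun y hy => by
    have := continuousAt_of_monotoneOn_of_image_mem_nhds hTmono (Ioc_mem_nhds hy.1 hy.2)
      (mem_of_superset (Iic_mem_nhds (neg_neg_of_pos (hTpos y hy))) himage)
    exact this.neg.congr (Eventually.of_forall fun z => neg_neg (T z))
  have hTcontb : ContinuousWithinAt T (Iic b) b := by
    have := continuousWithinAt_left_of_monotoneOn_of_image_mem_nhdsWithin (a := b) hTmono
      (Ioc_mem_nhdsLE hb) (by
        simp only [hTb, neg_zero]
        exact mem_of_superset self_mem_nhdsWithin himage)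
    exact this.neg.congr (fun z _ => (neg_neg (T z)).symm) (neg_neg (T b)).symm
  have hTcontOn : ContinuousOn T (Ioc 1 b) := fun y hy => by
    rcases hy.2.eq_or_lt with rfl | hlt
    · exact hTcontb.mono Ioc_subset_Iic_self
    · exact (hTcont y ⟨hy.1, hlt⟩).continuousWithinAt
  have hderT : ∀ y ∈ Ioo 1 b, HasDerivAt T (w (T y))⁻¹ y := fun y hy => by
    refine HasDerivAt.of_local_left_inverse (hTcont y hy)
      ((h.hasDeriv_u _ (hTpos y hy).le).hasDerivAt (Ici_mem_nhds (hTpos y hy)))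
      (h.w_neg hφ hb (hTpos y hy).le).ne ?_
    filter_upwards [Ioo_mem_nhds hy.1 hy.2] with z hz using huT z (Ioo_subset_Ioc_self hz)
  refine ⟨f ∘ T, fun y => -w (T y), ?_, ?_, fun y hy => ?_, ?_, ?_, fun y hy => ?_, fun y hy => ?_,
    fun ε hε => ?_⟩
  · simp [hTb, h.f_zero]
  · simp [hTb]
  · exact neg_pos.2 (h.w_neg hφ hb (hT0 y hy))
  · exact h.continuousOn_f.comp hTcontOn hT0
  · exact (h.continuousOn_w.comp hTcontOn hT0).neg
  · have h1 := (h.hasDeriv_f _ (hTpos y hy).le).hasDerivAt (Ici_mem_nhds (hTpos y hy))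
    refine (h1.comp y (hderT y hy)).congr_deriv ?_
    rw [huT y (Ioo_subset_Ioc_self hy), neg_div_neg_eq, div_eq_mul_inv]
  · have h1 := (h.hasDeriv_w _ (hTpos y hy).le).hasDerivAt (Ici_mem_nhds (hTpos y hy))
    refine (h1.comp y (hderT y hy)).neg.congr_deriv ?_
    have h2 := (h.w_neg hφ hb (hTpos y hy).le).ne
    rw [huT y (Ioo_subset_Ioc_self hy)]
    simp only [Function.comp]
    field_simp
    ring
  · obtain ⟨t, ht0, ht⟩ := ((eventually_ge_atTop (0 : ℝ)).and
      ((h.w_tendsto hκ hφ).eventually (lt_mem_nhds (neg_lt_zero.2 hε)))).exists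
    refine ⟨u t, hu_mem t ht0, ?_⟩
    simp only [hTu t ht0]
    linarith

/-- Suppose p₁(b) < p₂(b). While p₁ ≤ p₂, the equation for v gives v₁ ≥ v₂ and then the equation for
p gives p₁' ≥ p₂'. Hence p₂ - p₁ never falls below its value at b, which contradicts p₁ > 0 once p₂
is smaller than that value. -/
theorem w_zero_le (h : IsDecreasingProfile κ φ a b f u w) {g u₂ w₂ : ℝ → ℝ}
    (h₂ : IsDecreasingProfile κ φ a b g u₂ w₂) (hκ : 0 < κ) (hφ : IsForcing φ b) (hb : 1 < b) :
    w 0 ≤ w₂ 0 := by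
  by_contra! hlt
  obtain ⟨v₁, p₁, va₁, pb₁, pos₁, cv₁, cp₁, dv₁, dp₁, -⟩ := h.exists_crocco hκ hφ hb
  obtain ⟨v₂, p₂, va₂, pb₂, pos₂, cv₂, cp₂, dv₂, dp₂, small⟩ := h₂.exists_crocco hκ hφ hb
  have hδ : p₁ b < p₂ b := by rw [pb₁, pb₂]; linarith
  -- as long as `p₁ ≤ p₂` on `[y, b]`, the difference `p₁ - p₂` is monotone there
  have step : ∀ y ∈ Ioc 1 b, (∀ z ∈ Ioo y b, p₁ z ≤ p₂ z) → p₁ y - p₂ y ≤ p₁ b - p₂ b := by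
    intro y hy hle
    have hsub : Icc y b ⊆ Ioc 1 b := fun z hz => ⟨hy.1.trans_le hz.1, hz.2⟩
    have hsub' : Ioo y b ⊆ Ioo 1 b := Ioo_subset_Ioo_left hy.1.le
    have hinv : ∀ z ∈ Ioo y b, (p₂ z)⁻¹ ≤ (p₁ z)⁻¹ := fun z hz =>
      inv_anti₀ (pos₁ z (hsub (Ioo_subset_Icc_self hz))) (hle z hz)
    have hv : AntitoneOn (fun z => v₁ z - v₂ z) (Icc y b) := by
      refine antitoneOn_of_hasDerivWithinAt_nonpos (f' := fun z => -z / p₁ z - -z / p₂ z)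
        (convex_Icc y b) ((cv₁.mono hsub).sub (cv₂.mono hsub)) (fun z hz => ?_) fun z hz => ?_
      · rw [interior_Icc] at hz
        exact ((dv₁ z (hsub' hz)).sub (dv₂ z (hsub' hz))).hasDerivWithinAt
      · rw [interior_Icc] at hz
        have := mul_le_mul_of_nonneg_left (hinv z hz) (zero_le_one.trans (hsub' hz).1.le)
        simp only [div_eq_mul_inv]
        linarith
    have hp : MonotoneOn (fun z => p₁ z - p₂ z) (Icc y b) := by
      refine monotoneOn_of_hasDerivWithinAt_nonneg
        (f' := fun z => (κ * v₁ z + φ z / p₁ z) - (κ * v₂ z + φ z / p₂ z))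
        (convex_Icc y b) ((cp₁.mono hsub).sub (cp₂.mono hsub)) (fun z hz => ?_) fun z hz => ?_
      · rw [interior_Icc] at hz
        exact ((dp₁ z (hsub' hz)).sub (dp₂ z (hsub' hz))).hasDerivWithinAt
      · rw [interior_Icc] at hz
        have h1 := mul_le_mul_of_nonneg_left (hinv z hz)
          (hφ.nonneg ⟨(hsub' hz).1.le, (hsub' hz).2.le⟩)
        have h2 := hv (Ioo_subset_Icc_self hz) ⟨hy.2, le_rfl⟩ hz.2.le
        simp only [va₁, va₂, sub_self] at h2
        have h3 := mul_nonneg hκ.le h2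
        simp only [div_eq_mul_inv]
        linarith
    exact hp ⟨le_rfl, hy.2⟩ ⟨hy.2, le_rfl⟩ hy.2
  have hlt' : ∀ y ∈ Ioc 1 b, p₁ y < p₂ y := by
    intro y hy
    by_contra! hge
    have hsub : Icc y b ⊆ Ioc 1 b := fun z hz => ⟨hy.1.trans_le hz.1, hz.2⟩
    have hcomp : IsCompact {z ∈ Icc y b | p₂ z ≤ p₁ z} :=
      isCompact_Icc.of_isClosed_subset
        (isClosed_Icc.isClosed_le (cp₂.mono hsub) (cp₁.mono hsub)) fun z hz => hz.1
    -- At the crossing point nearest to b, `step` applies above it and yields p₁ < p₂ there.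
    obtain ⟨z, ⟨hz, hpz⟩, hmax⟩ := hcomp.exists_isGreatest ⟨y, ⟨le_rfl, hy.2⟩, hge⟩
    have := step z (hsub hz) fun x hx => by
      by_contra! hxp
      exact hx.1.not_ge (hmax ⟨⟨hz.1.trans hx.1.le, hx.2.le⟩, hxp.le⟩)
    linarith
  obtain ⟨y, hy, hsmall⟩ := small (p₂ b - p₁ b) (sub_pos.2 hδ)
  have h1 := step y hy fun z hz => (hlt' z ⟨hy.1.trans hz.1, hz.2.le⟩).le
  linarith [pos₁ y hy]

theorem eqOn_f (h : IsDecreasingProfile κ φ a b f u w) {g u₂ w₂ : ℝ → ℝ}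
    (h₂ : IsDecreasingProfile κ φ a b g u₂ w₂) (hκ : 0 < κ) (hφ : IsForcing φ b) (hb : 1 < b) :
    EqOn f g (Ici 0) := fun t ht =>
  ((h.isClampedTrajectory.mono Icc_subset_Ici_self).eqOn
    (h₂.isClampedTrajectory.mono Icc_subset_Ici_self) hb hφ (h.f_zero.trans h₂.f_zero.symm)
    h.u_zero h₂.u_zero (le_antisymm (h.w_zero_le h₂ hκ hφ hb) (h₂.w_zero_le h hκ hφ hb))
    t (right_mem_Icc.2 ht)).1

end IsDecreasingProfile

/-! ### Existence of clamped trajectories -/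

/-- The truncated field is bounded and globally Lipschitz, so Picard–Lindelöf reaches all of [0, T]
in one step; the a priori bound then removes the truncation. -/
theorem exists_clampedTrajectory_Icc (κ : ℝ) {φ : ℝ → ℝ} {b : ℝ} (a c : ℝ) {T : ℝ} (hT : 0 ≤ T)
    (hb : 1 < b) (hφ : IsForcing φ b) : ∃ f u w : ℝ → ℝ,
      IsClampedTrajectory κ φ b (Icc 0 T) f u w ∧ f 0 = a ∧ u 0 = b ∧ w 0 = c := by
  obtain ⟨R, hR0, hR⟩ := exists_apriori_bound κ a |c| T hb (abs_nonneg c) hφ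
  obtain ⟨K, hK⟩ := exists_lipschitzWith_truncatedField κ hb hR0 hφ
  obtain ⟨L, hL0, hL⟩ := hφ.exists_le_mul
  have hbound : ∀ x, ‖truncatedField κ φ b R x‖ ≤ b + R + |κ| * R * R + L * (b - 1) := by
    intro x
    have hc := clamp_mem hb.le x.2.1
    have h1 := abs_clamp_le hR0 x.1
    have h2 := abs_clamp_le hR0 x.2.2
    have h3 := abs_clamped_rhs_le (κ := κ) hb hφ (clamp (-R) R x.1) x.2.1
      (clamp (-R) R x.2.2)
    have h4 : |κ| * |clamp (-R) R x.1| * |clamp (-R) R x.2.2| ≤ |κ| * R * R := by gcongr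
    have h5 : L * (clamp 1 b x.2.1 - 1) ≤ L * (b - 1) :=
      mul_le_mul_of_nonneg_left (by linarith [hc.2]) hL0
    have h6 : 0 ≤ |κ| * R * R := by positivity
    have h7 : 0 ≤ L * (b - 1) := mul_nonneg hL0 (by linarith)
    simp only [truncatedField, Prod.norm_def, Real.norm_eq_abs, max_le_iff]
    refine ⟨?_, ?_, ?_⟩
    · rw [abs_of_nonneg (by linarith [hc.1])]
      linarith [hc.2]
    · linarith
    · linarith [hL _ hc]
  have hB : 0 ≤ b + R + |κ| * R * R + L * (b - 1) := (norm_nonneg _).trans (hbound 0)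
  set B : NNReal := ⟨_, hB⟩
  -- The ball has radius B·T, exactly the distance a curve of speed at most B can travel.
  have hPL : IsPicardLindelof (fun _ => truncatedField κ φ b R)
      (⟨0, le_rfl, hT⟩ : Icc (0 : ℝ) T) (a, b, c) (B * ⟨T, hT⟩) 0 B K := by
    refine ⟨fun t _ => hK.lipschitzOnWith, fun x _ => continuousOn_const,
      fun t _ x _ => hbound x, ?_⟩
    rw [sub_self, sub_zero, max_eq_left hT, NNReal.coe_zero, sub_zero]
    exact (NNReal.coe_mul B ⟨T, hT⟩).ge
  obtain ⟨x, hx0, hx⟩ := hPL.exists_eq_forall_mem_Icc_hasDerivWithinAt₀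
  simp only at hx0
  have d1 : ∀ t ∈ Icc 0 T, HasDerivWithinAt (fun t => (x t).1) (clamp 1 b (x t).2.1)
      (Icc 0 T) t := fun t ht => (hx t ht).fst
  have d2 : ∀ t ∈ Icc 0 T, HasDerivWithinAt (fun t => (x t).2.1) (clamp (-R) R (x t).2.2)
      (Icc 0 T) t := fun t ht => (hx t ht).snd.fst
  have d3 : ∀ t ∈ Icc 0 T, HasDerivWithinAt (fun t => (x t).2.2)
      (-κ * clamp (-R) R (x t).1 * clamp (-R) R (x t).2.2 + φ (clamp 1 b (x t).2.1))
      (Icc 0 T) t := fun t ht => (hx t ht).snd.snd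
  -- No circularity: truncation only decreases |f| and |w|, so the growth hypothesis of the a priori
  -- bound holds before the truncation is known to be inactive.
  have hbd := hR _ _ _ _ (by simp [hx0]) (by simp [hx0]) d1 d3 (fun t _ => clamp_mem hb.le _)
    fun t _ => (abs_clamped_rhs_le hb hφ _ _ _).trans (by
      gcongr ?_ + _
      exact mul_le_mul (mul_le_mul_of_nonneg_left (abs_clamp_le_abs hR0 _) (abs_nonneg _))
        (abs_clamp_le_abs hR0 _) (abs_nonneg _) (by positivity))
  refine ⟨fun t => (x t).1, fun t => (x t).2.1, fun t => (x t).2.2,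
    ⟨d1, fun t ht => ?_, fun t ht => ?_⟩, by simp [hx0], by simp [hx0], by simp [hx0]⟩
  · exact (d2 t ht).congr_deriv (clamp_of_abs_le (hbd t ht).2)
  · refine (d3 t ht).congr_deriv ?_
    rw [clamp_of_abs_le (hbd t ht).1, clamp_of_abs_le (hbd t ht).2]

theorem exists_clampedTrajectory (κ : ℝ) {φ : ℝ → ℝ} {b : ℝ} (a c : ℝ) (hb : 1 < b)
    (hφ : IsForcing φ b) : ∃ f u w : ℝ → ℝ,
      IsClampedTrajectory κ φ b (Ici 0) f u w ∧ f 0 = a ∧ u 0 = b ∧ w 0 = c := by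
  choose f u w hx hf hu hw using fun n : ℕ =>
    exists_clampedTrajectory_Icc κ a c (T := n) n.cast_nonneg hb hφ
  have hle : ∀ {m n : ℕ}, m ≤ n → ∀ t ∈ Icc 0 (m : ℝ),
      f m t = f n t ∧ u m t = u n t ∧ w m t = w n t := fun {m n} hmn =>
    (hx m).eqOn ((hx n).mono (Icc_subset_Icc_right (Nat.cast_le.2 hmn))) hb hφ
      ((hf m).trans (hf n).symm) (hu m) (hu n) ((hw m).trans (hw n).symm)
  have hglue : ∀ t : ℝ, 0 ≤ t → ∃ n : ℕ, Icc 0 (n : ℝ) ∈ 𝓝[Ici 0] t ∧ t ∈ Icc 0 (n : ℝ) ∧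
      ∀ s ∈ Icc 0 (n : ℝ), f ⌈s⌉₊ s = f n s ∧ u ⌈s⌉₊ s = u n s ∧ w ⌈s⌉₊ s = w n s := by
    intro t ht
    -- One more than the ceiling, so that the interval is a neighbourhood of t in [0, ∞) even at
    -- integer t.
    have hlt : t < (⌈t⌉₊ + 1 : ℕ) := by
      push_cast
      linarith [Nat.le_ceil t]
    refine ⟨⌈t⌉₊ + 1, ?_, ⟨ht, hlt.le⟩, fun s hs =>
      hle (Nat.ceil_le.2 hs.2) s ⟨hs.1, Nat.le_ceil s⟩⟩
    rw [← Ici_inter_Iic]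
    exact inter_mem self_mem_nhdsWithin (mem_nhdsWithin_of_mem_nhds (Iic_mem_nhds hlt))
  refine ⟨fun t => f ⌈t⌉₊ t, fun t => u ⌈t⌉₊ t, fun t => w ⌈t⌉₊ t,
    ⟨fun t ht => ?_, fun t ht => ?_, fun t ht => ?_⟩, by simp [hf], by simp [hu], by simp [hw]⟩
  all_goals
    obtain ⟨n, hn, htn, heq⟩ := hglue t ht
    obtain ⟨e1, e2, e3⟩ := heq t htn
    simp only [e1, e2, e3]
  · exact (((hx n).hasDeriv_f t htn).mono_of_mem_nhdsWithin hn).congr_of_eventuallyEq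
      (mem_of_superset hn fun s hs => (heq s hs).1) e1
  · exact (((hx n).hasDeriv_u t htn).mono_of_mem_nhdsWithin hn).congr_of_eventuallyEq
      (mem_of_superset hn fun s hs => (heq s hs).2.1) e2
  · exact (((hx n).hasDeriv_w t htn).mono_of_mem_nhdsWithin hn).congr_of_eventuallyEq
      (mem_of_superset hn fun s hs => (heq s hs).2.2) e3

/-! ### Shooting -/

namespace IsClampedTrajectory

variable {κ : ℝ} {φ : ℝ → ℝ} {b : ℝ} {f u w : ℝ → ℝ}

theorem continuousOn_f (h : IsClampedTrajectory κ φ b (Ici 0) f u w) : ContinuousOn f (Ici 0) :=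
  fun t ht => (h.hasDeriv_f t ht).continuousWithinAt

theorem continuousOn_w (h : IsClampedTrajectory κ φ b (Ici 0) f u w) : ContinuousOn w (Ici 0) :=
  fun t ht => (h.hasDeriv_w t ht).continuousWithinAt

/-- With G the primitive of κ f, the damping term disappears and w e^G has a derivative of the sign
of φ. -/
theorem exists_integratingFactor (h : IsClampedTrajectory κ φ b (Ici 0) f u w) :
    ∃ G : ℝ → ℝ, G 0 = 0 ∧ (∀ t, 0 ≤ t → HasDerivWithinAt G (κ * f t) (Ici 0) t) ∧
      ∀ t, 0 ≤ t → HasDerivWithinAt (fun t => w t * Real.exp (G t))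
        (φ (clamp 1 b (u t)) * Real.exp (G t)) (Ici 0) t := by
  -- The absolute value extends the integrand continuously to the whole line, so that 0 needs no
  -- separate treatment.
  have hc : Continuous fun t => κ * f |t| := continuous_const.mul
    (h.continuousOn_f.comp_continuous continuous_abs abs_nonneg)
  have hG : ∀ t, 0 ≤ t →
      HasDerivWithinAt (fun t => ∫ s in (0 : ℝ)..t, κ * f |s|) (κ * f t) (Ici 0) t := by
    intro t ht
    have := (hc.integral_hasStrictDerivAt 0 t).hasDerivAt.hasDerivWithinAt (s := Ici 0)
    rwa [abs_of_nonneg ht] at this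
  refine ⟨_, intervalIntegral.integral_same, hG, fun t ht => ?_⟩
  refine ((h.hasDeriv_w t ht).mul (hG t ht).exp).congr_deriv ?_
  ring

theorem w_pos_of_le (h : IsClampedTrajectory κ φ b (Ici 0) f u w) (hb : 1 < b)
    (hφ : IsForcing φ b) {s t : ℝ} (hs : 0 ≤ s) (hst : s ≤ t) (hw : 0 < w s) : 0 < w t := by
  obtain ⟨G, -, -, hd⟩ := h.exists_integratingFactor
  have := monotoneOn_of_hasDerivWithinAt_Ici (convex_Ici 0) subset_rfl hd
    (fun r _ => mul_nonneg (hφ.nonneg (clamp_mem hb.le _)) (Real.exp_pos _).le)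
    hs (hs.trans hst) hst
  exact pos_of_mul_pos_left ((mul_pos hw (Real.exp_pos _)).trans_le this) (Real.exp_pos _).le

/-- Up to the first zero of w, u decreases and stays below 1. The clamp then holds the argument of φ
at 1, where φ vanishes, so w e^G cannot increase to 0. -/
theorem w_neg_of_le (h : IsClampedTrajectory κ φ b (Ici 0) f u w) (hb : 1 < b)
    (hφ : IsForcing φ b) {s t : ℝ} (hs : 0 ≤ s) (hst : s ≤ t) (hu : u s < 1) (hw : w s < 0) :
    w t < 0 := by
  by_contra! hwt
  have hsub : Icc s t ⊆ Ici 0 := fun r hr => hs.trans hr.1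
  have hcomp : IsCompact {r ∈ Icc s t | 0 ≤ w r} :=
    isCompact_Icc.of_isClosed_subset
      (isClosed_Icc.isClosed_le continuousOn_const (h.continuousOn_w.mono hsub)) fun z hz => hz.1
  obtain ⟨z, ⟨hz, hwz⟩, hmin⟩ := hcomp.exists_isLeast ⟨t, ⟨hst, le_rfl⟩, hwt⟩
  have hneg : ∀ r ∈ Ico s z, w r < 0 := fun r hr => by
    by_contra! hwr
    exact hr.2.not_ge (hmin ⟨⟨hr.1, hr.2.le.trans hz.2⟩, hwr⟩)
  have hsub' : Icc s z ⊆ Ici 0 := fun r hr => hs.trans hr.1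
  have hanti := antitoneOn_of_hasDerivWithinAt_Ici (convex_Icc s z) hsub' h.hasDeriv_u
    fun r hr => by
      rw [interior_Icc] at hr
      exact (hneg r (Ioo_subset_Ico_self hr)).le
  obtain ⟨G, -, -, hd⟩ := h.exists_integratingFactor
  have := antitoneOn_of_hasDerivWithinAt_Ici (convex_Icc s z) hsub' hd
    (fun r hr => by
      have hr' := interior_subset hr
      rw [clamp_eq_left hb.le ((hanti ⟨le_rfl, hz.1⟩ hr' hr'.1).trans hu.le), hφ.one, zero_mul])
    ⟨le_rfl, hz.1⟩ ⟨hz.1, le_rfl⟩ hz.1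
  simp only at this
  have h1 := mul_neg_of_neg_of_pos hw (Real.exp_pos (G s))
  have h2 := mul_nonneg hwz (Real.exp_pos (G z)).le
  linarith

/-- Were u to fall below 1, it would pass a level strictly between its value and 1. From then on w ≥
0, so u could not have decreased further. -/
theorem one_le_u (h : IsClampedTrajectory κ φ b (Ici 0) f u w) (hb : 1 < b) (hu0 : u 0 = b)
    (hw : ∀ t, 0 ≤ t → w t ≤ 0) (huw : ∀ t, 0 ≤ t → u t < 1 → 0 ≤ w t) {t : ℝ} (ht : 0 ≤ t) :
    1 ≤ u t := by
  by_contra! hlt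
  have hanti := antitoneOn_of_hasDerivWithinAt_Ici (convex_Ici 0) subset_rfl h.hasDeriv_u
    fun r hr => hw r (interior_subset hr)
  obtain ⟨y, hy1, hy2⟩ := exists_between hlt
  obtain ⟨s, hs, rfl⟩ := intermediate_value_Icc' ht
    (fun r hr => ((h.hasDeriv_u r hr.1).mono Icc_subset_Ici_self).continuousWithinAt)
    ⟨hy1.le, by rw [hu0]; linarith⟩
  have hmono := monotoneOn_of_hasDerivWithinAt_Ici (convex_Icc s t)
    (fun r hr => hs.1.trans hr.1) h.hasDeriv_u (fun r hr => by
      have hr' := interior_subset hr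
      have hr0 : 0 ≤ r := hs.1.trans hr'.1
      exact huw r hr0 ((hanti hs.1 hr0 hr'.1).trans_lt hy2))
    ⟨le_rfl, hs.2⟩ ⟨hs.2, le_rfl⟩ hs.2
  linarith

/-- A clamped trajectory along which `w ≤ 0` and `u ≥ 1` is a decreasing profile. -/
theorem isDecreasingProfile (h : IsClampedTrajectory κ φ b (Ici 0) f u w) (hκ : 0 < κ)
    (hφ : IsForcing φ b) {a : ℝ} (hf0 : f 0 = a) (hu0 : u 0 = b)
    (hw : ∀ t, 0 ≤ t → w t ≤ 0) (hu : ∀ t, 0 ≤ t → 1 ≤ u t) :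
    IsDecreasingProfile κ φ a b f u w := by
  have hanti := antitoneOn_of_hasDerivWithinAt_Ici (convex_Ici 0) subset_rfl h.hasDeriv_u
    fun r hr => hw r (interior_subset hr)
  have hmem : ∀ t, 0 ≤ t → u t ∈ Icc 1 b := fun t ht =>
    ⟨hu t ht, hu0 ▸ hanti self_mem_Ici ht ht⟩
  have df : ∀ t, 0 ≤ t → HasDerivWithinAt f (u t) (Ici 0) t := fun t ht =>
    (h.hasDeriv_f t ht).congr_deriv (clamp_of_mem (hmem t ht))
  have dw : ∀ t, 0 ≤ t → HasDerivWithinAt w (-κ * f t * w t + φ (u t)) (Ici 0) t := fun t ht =>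
    (h.hasDeriv_w t ht).congr_deriv (by rw [clamp_of_mem (hmem t ht)])
  refine ⟨df, h.hasDeriv_u, dw, hf0, hu0, hw, ?_⟩
  have hm : Antitone fun t => u (max 0 t) := fun s t hst =>
    hanti (le_max_left 0 s) (le_max_left 0 t) (max_le_max le_rfl hst)
  have hbd : BddBelow (range fun t => u (max 0 t)) :=
    ⟨1, by rintro _ ⟨t, rfl⟩; exact hu _ (le_max_left 0 t)⟩
  have hlim := tendsto_atTop_ciInf hm hbd
  set y := ⨅ t, u (max 0 t)
  have hyu : ∀ t, 0 ≤ t → y ≤ u t := fun t ht => by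
    have := ciInf_le hbd t
    rwa [max_eq_right ht] at this
  have hy1 : 1 ≤ y := le_ciInf fun t => hu _ (le_max_left 0 t)
  -- If the limit y exceeded 1, φ would have a positive minimum φ(z) on [y, b]. Once t ≥ -a, f ≥ 0
  -- and therefore w' ≥ φ(z), which drives w above 0.
  have hy : y = 1 := by
    by_contra hne
    have hy1' : 1 < y := hy1.lt_of_ne (Ne.symm hne)
    obtain ⟨K, hK⟩ := hφ.lipschitz
    obtain ⟨z, hz, hmin⟩ := (isCompact_Icc (a := y) (b := b)).exists_isMinOn
      ⟨b, (hyu 0 le_rfl).trans hu0.le, le_rfl⟩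
      (hK.continuousOn.mono (Icc_subset_Icc_left hy1))
    have hδ : 0 < φ z := hφ.pos z (hy1'.trans_le hz.1) hz.2
    set s := max 0 (-a)
    have hs0 : 0 ≤ s := le_max_left _ _
    have hfmono := monotoneOn_of_hasDerivWithinAt_Ici (g := fun t => f t - t) (convex_Ici 0)
      subset_rfl (fun t ht => (df t ht).sub (hasDerivWithinAt_id t _))
      fun t ht => sub_nonneg.2 (hu t (interior_subset ht))
    have hmono := monotoneOn_of_hasDerivWithinAt_Ici (g := fun t => w t - φ z * t)
      (convex_Ici s) (Ici_subset_Ici.2 hs0)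
      (fun t ht => (dw t ht).sub ((hasDerivWithinAt_id t _).const_mul (φ z))) fun t ht => by
        have hst : s ≤ t := interior_subset ht
        have ht0 : 0 ≤ t := hs0.trans hst
        have h1 := hfmono self_mem_Ici ht0 ht0
        simp only [hf0] at h1
        have h2 : -a ≤ t := (le_max_right _ _).trans hst
        have h3 : 0 ≤ f t := by linarith
        have h4 := mul_nonneg (mul_nonneg hκ.le h3) (neg_nonneg.2 (hw t ht0))
        have h5 : φ z ≤ φ (u t) := hmin ⟨hyu t ht0, (hmem t ht0).2⟩
        linarith
    have hr : 0 ≤ (1 - w s) / φ z := div_nonneg (by linarith [hw s hs0]) hδ.le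
    have h1 := hmono self_mem_Ici (mem_Ici.2 (le_add_of_nonneg_right hr))
      (le_add_of_nonneg_right hr)
    simp only [mul_add, mul_div_cancel₀ _ hδ.ne'] at h1
    linarith [hw (s + (1 - w s) / φ z) (by linarith)]
  rw [← hy]
  refine hlim.congr' ?_
  filter_upwards [eventually_ge_atTop 0] with t ht
  rw [max_eq_right ht]

end IsClampedTrajectory

/-- If `w` starts sufficiently low, then `u` drops below `1`. -/
theorem exists_initial_undershoot {κ : ℝ} {φ : ℝ → ℝ} {b : ℝ} (a : ℝ) (hκ : 0 < κ) (hb : 1 < b)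
    (hφ : IsForcing φ b) : ∃ c ≤ 0, ∀ f u w : ℝ → ℝ, IsClampedTrajectory κ φ b (Ici 0) f u w →
      f 0 = a → u 0 = b → w 0 = c → u 1 < 1 ∧ w 1 < 0 := by
  obtain ⟨L, hL0, hL⟩ := hφ.exists_le_mul
  set K := κ * (|a| + b) with hK
  have hLb : 0 ≤ L * (b - 1) := mul_nonneg hL0 (by linarith)
  -- On [0, 1], G ≤ K and w e^G grows at rate at most L(b-1)e^K. Starting here it stays below -b
  -- e^K, so w ≤ -b and u(1) ≤ 0.
  refine ⟨-(L * (b - 1) * Real.exp K + b * Real.exp K), ?_, fun f u w h hf0 hu0 hw0 => ?_⟩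
  · have := Real.exp_pos K
    have : 0 ≤ b * Real.exp K := mul_nonneg (by linarith) this.le
    have : 0 ≤ L * (b - 1) * Real.exp K := by positivity
    linarith
  obtain ⟨G, hG0, hG, hd⟩ := h.exists_integratingFactor
  have hsub : Icc (0 : ℝ) 1 ⊆ Ici 0 := Icc_subset_Ici_self
  have hf : ∀ t ∈ Icc (0 : ℝ) 1, |f t| ≤ |a| + b := fun t ht => by
    have h1 := norm_image_sub_le_of_norm_deriv_le_segment' (C := b)
      (fun s hs => (h.hasDeriv_f s (hsub hs)).mono hsub) (fun s hs => by
        have := clamp_mem hb.le (u s)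
        rw [Real.norm_eq_abs, abs_of_nonneg (by linarith [this.1])]
        exact this.2) t ht
    rw [hf0, Real.norm_eq_abs, sub_zero] at h1
    have h2 := abs_add_le (f t - a) a
    rw [sub_add_cancel] at h2
    have h3 : b * t ≤ b * 1 := mul_le_mul_of_nonneg_left ht.2 (by linarith)
    linarith
  have hK0 : 0 ≤ K := by positivity
  have hGK : ∀ t ∈ Icc (0 : ℝ) 1, G t ≤ K := fun t ht => by
    have h1 := norm_image_sub_le_of_norm_deriv_le_segment' (C := K)
      (fun s hs => (hG s (hsub hs)).mono hsub) (fun s hs => by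
        rw [Real.norm_eq_abs, abs_mul, abs_of_pos hκ]
        exact mul_le_mul_of_nonneg_left (hf s (Ico_subset_Icc_self hs)) hκ.le) t ht
    rw [hG0, Real.norm_eq_abs, sub_zero, sub_zero] at h1
    have h3 : K * t ≤ K * 1 := mul_le_mul_of_nonneg_left ht.2 hK0
    linarith [le_abs_self (G t)]
  have hw : ∀ t ∈ Icc (0 : ℝ) 1, w t ≤ -b := fun t ht => by
    have hanti := antitoneOn_of_hasDerivWithinAt_Ici
      (g := fun t => w t * Real.exp (G t) - L * (b - 1) * Real.exp K * t) (convex_Icc 0 1) hsub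
      (fun s hs => (hd s hs).sub ((hasDerivWithinAt_id s _).const_mul _)) (fun s hs => by
        have hs' := interior_subset hs
        have hc := clamp_mem hb.le (u s)
        have h1 : φ (clamp 1 b (u s)) ≤ L * (b - 1) :=
          (hL _ hc).trans (mul_le_mul_of_nonneg_left (by linarith [hc.2]) hL0)
        have h2 := mul_le_mul h1 (Real.exp_le_exp.2 (hGK s hs')) (Real.exp_pos _).le hLb
        linarith) ⟨le_rfl, zero_le_one⟩ ht ht.1
    simp only [hG0, Real.exp_zero, hw0] at hanti
    have h1 : L * (b - 1) * Real.exp K * t ≤ L * (b - 1) * Real.exp K * 1 :=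
      mul_le_mul_of_nonneg_left ht.2 (mul_nonneg hLb (Real.exp_pos _).le)
    have h2 : b * Real.exp (G t) ≤ b * Real.exp K :=
      mul_le_mul_of_nonneg_left (Real.exp_le_exp.2 (hGK t ht)) (by linarith)
    refine le_of_mul_le_mul_right ?_ (Real.exp_pos (G t))
    linarith
  have hu := antitoneOn_of_hasDerivWithinAt_Ici (g := fun t => u t + b * t) (convex_Icc 0 1) hsub
    (fun s hs => (h.hasDeriv_u s hs).add ((hasDerivWithinAt_id s _).const_mul _)) (fun s hs => by
      linarith [hw s (interior_subset hs)])
    ⟨le_rfl, zero_le_one⟩ ⟨zero_le_one, le_rfl⟩ zero_le_one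
  simp only [hu0] at hu
  exact ⟨by linarith, by linarith [hw 1 ⟨zero_le_one, le_rfl⟩]⟩

theorem exists_isDecreasingProfile {κ : ℝ} {φ : ℝ → ℝ} {b : ℝ} (a : ℝ) (hκ : 0 < κ) (hb : 1 < b)
    (hφ : IsForcing φ b) : ∃ f u w : ℝ → ℝ, IsDecreasingProfile κ φ a b f u w := by
  choose f u w hx hf hu hw using fun c : ℝ => exists_clampedTrajectory κ a c hb hφ
  have hcont : ∀ t, 0 ≤ t → (Continuous fun c => u c t) ∧ Continuous fun c => w c t := by
    intro t ht
    have key : ∀ c₀, ∃ K : ℝ, ∀ᶠ c in 𝓝 c₀,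
        |u c t - u c₀ t| ≤ |c - c₀| * K ∧ |w c t - w c₀ t| ≤ |c - c₀| * K := by
      intro c₀
      obtain ⟨K, hK⟩ := exists_dist_clampedTrajectory_le κ a (|c₀| + 1) t hb (by positivity) hφ
      refine ⟨K, ?_⟩
      have hev : ∀ᶠ c in 𝓝 c₀, |c| < |c₀| + 1 :=
        continuous_abs.continuousAt.eventually (gt_mem_nhds (lt_add_one _))
      filter_upwards [hev] with c hc
      have := hK _ _ _ _ _ _ ((hx c).mono Icc_subset_Ici_self)
        ((hx c₀).mono Icc_subset_Ici_self) (hf c) (hf c₀) (hu c) (hu c₀)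
        (by rw [hw]; exact hc.le) (by rw [hw]; linarith) t (right_mem_Icc.2 ht)
      rw [hw, hw] at this
      exact this.2
    have hz : ∀ c₀ K : ℝ, Tendsto (fun c => |c - c₀| * K) (𝓝 c₀) (𝓝 0) := fun c₀ K => by
      have : Continuous fun c => |c - c₀| * K := by fun_prop
      simpa using this.tendsto c₀
    constructor <;> refine continuous_iff_continuousAt.2 fun c₀ => ?_ <;>
      obtain ⟨K, hK⟩ := key c₀ <;> refine tendsto_iff_dist_tendsto_zero.2 ?_ <;>
      refine squeeze_zero' (Eventually.of_forall fun _ => dist_nonneg) ?_ (hz c₀ K)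
    · exact hK.mono fun c hc => hc.1
    · exact hK.mono fun c hc => hc.2
  -- initial slopes for which `u` crosses `1`, and for which `w` changes sign
  set A : Set ℝ := ⋃ t ∈ Ici (0 : ℝ), {c | u c t < 1} ∩ {c | w c t < 0} with hA
  set B : Set ℝ := ⋃ t ∈ Ici (0 : ℝ), {c | 0 < w c t} with hB
  have hAo : IsOpen A := isOpen_biUnion fun t ht =>
    (isOpen_lt (hcont t ht).1 continuous_const).inter (isOpen_lt (hcont t ht).2 continuous_const)
  have hBo : IsOpen B := isOpen_biUnion fun t ht => isOpen_lt continuous_const (hcont t ht).2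
  have hdisj : ∀ c ∈ A, c ∉ B := by
    intro c hcA hcB
    simp only [hA, hB, mem_iUnion, mem_inter_iff, mem_ofPred_eq, exists_prop, mem_Ici] at hcA hcB
    obtain ⟨s, hs, hus, hws⟩ := hcA
    obtain ⟨t, ht, hwt⟩ := hcB
    -- Both sign conditions persist forward, so they collide at the later of the two times.
    exact lt_asymm ((hx c).w_neg_of_le hb hφ hs (le_max_left s t) hus hws)
      ((hx c).w_pos_of_le hb hφ ht (le_max_right s t) hwt)
  have hAne : (Iic 0 ∩ A).Nonempty := by
    obtain ⟨c, hc, hcu⟩ := exists_initial_undershoot a hκ hb hφ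
    exact ⟨c, hc, mem_biUnion (mem_Ici.2 zero_le_one) (hcu _ _ _ (hx c) (hf c) (hu c) (hw c))⟩
  have hBne : (Iic 0 ∩ B).Nonempty := by
    -- For c = 0, w starts at 0 with slope φ(b) > 0, so it becomes positive.
    refine ⟨0, self_mem_Iic, ?_⟩
    by_contra hB0
    simp only [hB, mem_iUnion, mem_ofPred_eq, exists_prop, mem_Ici, not_exists, not_and,
      not_lt] at hB0
    have hd := deriv_nonpos_of_isMaxOn_right le_rfl ((hx 0).hasDeriv_w 0 self_mem_Ici)
      fun s hs => (hB0 s hs).trans (hw 0).ge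
    rw [hw, hu, mul_zero, zero_add, clamp_of_mem ⟨hb.le, le_rfl⟩] at hd
    exact hd.not_gt (hφ.pos b hb le_rfl)
  obtain ⟨c, -, hc⟩ : ∃ c ∈ Iic (0 : ℝ), c ∉ A ∪ B := by
    by_contra! hcov
    obtain ⟨c, -, hcA, hcB⟩ := isPreconnected_Iic A B hAo hBo hcov hAne hBne
    exact hdisj c hcA hcB
  simp only [hA, hB, mem_union, mem_iUnion, mem_inter_iff, mem_ofPred_eq, exists_prop, mem_Ici,
    not_or, not_exists, not_and, not_lt] at hc
  exact ⟨f c, u c, w c, (hx c).isDecreasingProfile hκ hφ (hf c) (hu c) hc.2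
    fun t ht => (hx c).one_le_u hb (hu c) hc.2 hc.1 ht⟩

/-! ### The concrete nonlinearity and the final theorem -/

theorem isForcing_forcing {m M b : ℝ}
    (hmM : (-1 < m ∧ m ≤ 0 ∧ M > -m * (b + 1)) ∨ (0 < m ∧ M ≥ -2 * m)) :
    IsForcing (forcing m M) b := by
  refine ⟨by simp [forcing], fun y hy hyb => mul_pos (sub_pos.2 hy) ?_, ?_⟩
  -- The factor m(1+y) + M is affine in y. For m ≤ 0 it is least at y = b, where the strict
  -- inequality on M makes it positive. For m > 0 it exceeds its value 2m + M ≥ 0 at y = 1.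
  · rcases hmM with ⟨-, hm, hM⟩ | ⟨hm, hM⟩ <;> nlinarith
  · have hC : ContDiff ℝ 1 (forcing m M) := by unfold forcing; fun_prop
    exact hC.contDiffOn.exists_lipschitzOnWith one_ne_zero (convex_Icc 1 b) isCompact_Icc

theorem mainTheorem1 (m M a b : ℝ) (hb : 1 < b)
    (hmM : (-1 < m ∧ m ≤ 0 ∧ M > -m * (b + 1)) ∨ (0 < m ∧ M ≥ -2 * m)) :
    ∃ f : ℝ → ℝ, IsConcaveSolution m M a b f ∧
      (∀ g : ℝ → ℝ, IsConcaveSolution m M a b g → EqOn g f (Ici 0)) ∧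
      ∃ l : ℝ, a < l ∧ l < Real.sqrt (a ^ 2 + 4 * ((b - 1) / (m + 1))) ∧
        Tendsto (fun t => f t - (t + l)) atTop (𝓝 0) ∧
        ∀ t : ℝ, 0 ≤ t → t + a ≤ f t ∧ f t ≤ t + l := by
  have hφ := isForcing_forcing hmM
  have hm : 0 < m + 1 := by rcases hmM with ⟨hm, -⟩ | ⟨hm, -⟩ <;> linarith
  have hκ : 0 < (m + 1) / 2 := by positivity
  obtain ⟨f, u, w, h⟩ := exists_isDecreasingProfile a hκ hb hφ
  obtain ⟨l, hal, hl, hlim, hle⟩ := h.exists_asymptote hκ hφ hb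
  refine ⟨f, h.isConcaveSolution, fun g hg => hg.isDecreasingProfile.eqOn_f h hκ hφ hb,
    l, hal, Real.lt_sqrt_of_sq_lt ?_, hlim, hle⟩
  convert hl using 2
  field_simp
  ring
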